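/- Fix a countably infinite set of variables. A CNF is a finite set of non-tautological clauses, a clause being a finite set of literals; $\mathrm{size}(F)=\sum_{C\in F}|C|$. A binary decision diagram (BDD) on a finite set of variables is a finite labelled directed acyclic graph with exactly one source, with at most one sink for each of the labels $0$ and $1$ and no other sinks, in which every non-sink node is labelled by a variable and has exactly two outgoing edges, labelled $0$ and $1$. It computes the Boolean function whose value at an assignment is the label of the sink reached from the source by following the edges that agree with the assignment. It is an OBDD if for some linear order of the variables, every edge between two non-sink nodes goes from a node labelled $x$ to a node labelled $y$ with $x<y$. The OBDD size of $F$ is the least number of nodes of an OBDD on the variables of $F$ that computes the Boolean function of $F$. A finite graph $G=(V,E)$ is an $(n,d,a)$-expander (for integers $n\ge 1$, $d\ge 3$ and a real $0<a<1$) if $|V|=n$, every vertex has degree at most $d$, and for every $W\subseteq V$ with $|W|\le n/2$, at least $a|W|$ vertices outside $W$ have a neighbor in $W$. The graph CNF of a finite graph $G=(V,E)$ without isolated vertices, whose vertices are variables, is $\{\{u,v\} : uv\in E\}$ (all literals positive). **Theorem.** There exist a class $\mathcal F$ of CNFs, containing formulas of arbitrarily large size, and real constants $a$ and $c>0$ such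 that every $F\in\mathcal F$ has the following properties: 1. $F$ is read $3$ times (every variable occurs in at most $3$ clauses), monotone (all literals are positive) and a $2$-CNF (every clause has exactly two literals); 2. $F$ is the graph CNF of an $(n,3,a)$-expander for some $n$; 3. the OBDD size of $F$ is at least $2^{c\cdot \mathrm{size}(F)}$. -/

import Mathlib

namespace OBDDLower

/-! ### CNF formulas -/

/-- A literal over the variables `X`: `(x, true)` is the literal `x`, `(x, false)` is `¬x`. -/
abbrev Literal (X : Type) : Type := X × Bool

/-- A clause is a finite set of literals. -/
abbrev Clause (X : Type) : Type := Finset (Literal X)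

/-- The set `var(C)` of variables of a clause. -/
def clauseVars {X : Type} [DecidableEq X] (C : Clause X) : Finset X := C.image Prod.fst

/-- A CNF is a finite set of non-tautological clauses. -/
structure CNF (X : Type) where
  clauses : Finset (Clause X)
  nontautological : ∀ C ∈ clauses, ∀ x : X, ¬ ((x, true) ∈ C ∧ (x, false) ∈ C)

namespace CNF

variable {X : Type}

/-- The size of a CNF: the sum of the sizes of its clauses. -/
def size (F : CNF X) : ℕ := ∑ C ∈ F.clauses, C.card

variable [DecidableEq X]

/-- The set `var(F)` of variables of a CNF. -/
def vars (F : CNF X) : Finset X := F.clauses.biUnion clauseVars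

/-- The assignment `f : var(F) → {0,1}` satisfies `F`: every clause of `F` contains one of the
literals made true by `f`. -/
def Satisfies (F : CNF X) (f : F.vars → Bool) : Prop :=
  ∀ C ∈ F.clauses, ∃ x : F.vars, ((x : X), f x) ∈ C

open Classical in
/-- The Boolean function computed by a CNF, in the variables `var(F)`. -/
noncomputable def boolFun (F : CNF X) (f : F.vars → Bool) : Bool := decide (F.Satisfies f)

/-- Every variable occurs at most `k` times (a variable occurs at most once in each clause, since
clauses are non-tautological sets of literals). -/
def IsReadTimes (F : CNF X) (k : ℕ) : Prop :=
  ∀ x : X, (F.clauses.filter (fun C => x ∈ clauseVars C)).card ≤ k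

end CNF

/-- All literals of `F` are positive. -/
def CNF.IsMonotone {X : Type} (F : CNF X) : Prop :=
  ∀ C ∈ F.clauses, ∀ l ∈ C, l.2 = true

/-- Every clause of `F` consists of exactly `k` literals. -/
def CNF.IsExactCNF {X : Type} (F : CNF X) (k : ℕ) : Prop :=
  ∀ C ∈ F.clauses, C.card = k

/-! ### Binary decision diagrams -/

/-- The kind of a node of a BDD on variables `V` with nodes `N`: a sink labelled `0` or `1`, or a
node labelled with a variable `x` that has exactly two outgoing edges, the one labelled `b` leading
to `child b`. -/
inductive NodeKind (V N : Type) where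
  | sink (b : Bool) : NodeKind V N
  | decision (x : V) (child : Bool → N) : NodeKind V N

/-- There is an edge from `u` to `v`. -/
def Edge {V N : Type} (kind : N → NodeKind V N) (u v : N) : Prop :=
  ∃ (x : V) (child : Bool → N) (b : Bool), kind u = .decision x child ∧ child b = v

/-- A binary decision diagram on variables `V`: a finite labelled directed acyclic graph with at
most one sink for each of the labels `0` and `1`, and with exactly one node without incoming
edges, its source. -/
structure BDD (V : Type) where
  Node : Type
  finite_node : Finite Node
  kind : Node → NodeKind V Node
  acyclic : ∀ u : Node, ¬ Relation.TransGen (Edge kind) u u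
  sink_unique : ∀ (b : Bool) (u v : Node), kind u = .sink b → kind v = .sink b → u = v
  source : Node
  source_iff : ∀ v : Node, (¬ ∃ u : Node, Edge kind u v) ↔ v = source

namespace BDD

variable {V : Type}

/-- The size of a BDD is the number of its nodes. -/
noncomputable def size (D : BDD V) : ℕ := Nat.card D.Node

/-- There is an edge from `u` to `v` that is activated by `β`. -/
def ActiveEdge (D : BDD V) (β : V → Bool) (u v : D.Node) : Prop :=
  ∃ (x : V) (child : Bool → D.Node), D.kind u = .decision x child ∧ child (β x) = v

/-- `D` computes `f`: for every `β`, the sink that is reached from the source along edges activated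
by `β` is labelled `f β`. -/
def Computes (D : BDD V) (f : (V → Bool) → Bool) : Prop :=
  ∀ β : V → Bool, ∃ t : D.Node,
    Relation.ReflTransGen (D.ActiveEdge β) D.source t ∧ D.kind t = .sink (f β)

/-- `D` is a `σ`-OBDD: along every edge between nodes labelled with variables, the variable
increases with respect to `σ`. -/
def IsOrderedBy (D : BDD V) (σ : LinearOrder V) : Prop :=
  ∀ (u v : D.Node) (x y : V) (cu cv : Bool → D.Node),
    D.kind u = .decision x cu → D.kind v = .decision y cv → Edge D.kind u v → σ.lt x y

/-- `D` is an OBDD. -/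
def IsOBDD (D : BDD V) : Prop := ∃ σ : LinearOrder V, D.IsOrderedBy σ

end BDD

/-- The sizes of the OBDDs on variables `V` computing `f`. -/
def obddSizes {V : Type} (f : (V → Bool) → Bool) : Set ℕ :=
  {s | ∃ D : BDD V, D.IsOBDD ∧ D.Computes f ∧ D.size = s}

/-- The OBDD size of a Boolean function: the size of a smallest OBDD computing it. For finitely
many variables there is such an OBDD, see `obddSizes_nonempty`. -/
noncomputable def obddSize {V : Type} (f : (V → Bool) → Bool) : ℕ := sInf (obddSizes f)

/-- Every Boolean function of finitely many variables is computed by some OBDD. -/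
theorem obddSizes_nonempty {V : Type} [Finite V] (f : (V → Bool) → Bool) :
    (obddSizes f).Nonempty := by
  classical
  have := Fintype.ofFinite V
  obtain ⟨n, ⟨e⟩⟩ := Finite.exists_equiv_fin V
  -- nodes: levels `k < n` with an assignment that vanishes from `k` on, and the needed sinks
  let N : Type := {p : Fin n × (V → Bool) // ∀ x, p.1 ≤ e x → p.2 x = false} ⊕
    {b : Bool // ∃ β, f β = b}
  let mk : (k : ℕ) → (g : V → Bool) → (∀ x, k ≤ (e x : ℕ) → g x = false) → N := fun k g hg =>
    if h : k < n then .inl ⟨(⟨k, h⟩, g), fun x hx => hg x hx⟩ else .inr ⟨f g, g, rfl⟩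
  have upd : ∀ (k : Fin n) (g : V → Bool), (∀ x, k ≤ e x → g x = false) → ∀ b : Bool,
      ∀ x, (k : ℕ) + 1 ≤ (e x : ℕ) → Function.update g (e.symm k) b x = false := by
    intro k g hg b x hx
    have hne : x ≠ e.symm k := by
      rintro rfl
      simp at hx
    rw [Function.update_of_ne hne]
    exact hg x (by rw [Fin.le_def]; omega)
  let kind : N → NodeKind V N := fun u => match u with
    | .inl p => .decision (e.symm p.1.1)
        (fun b => mk (p.1.1 + 1) (Function.update p.1.2 (e.symm p.1.1) b) (upd p.1.1 p.1.2 p.2 b))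
    | .inr b => .sink b.1
  let rank : N → ℕ := fun u => match u with
    | .inl p => p.1.1
    | .inr _ => n
  have rank_mk : ∀ k g hg, k ≤ n → rank (mk k g hg) = k := by
    intro k g hg hk
    by_cases h : k < n
    · simp [mk, h, rank]
    · have : k = n := by omega
      simp [mk, rank, this]
  have rank_edge : ∀ u v, Edge kind u v → rank v = rank u + 1 := by
    rintro (p | b) v ⟨x, ch, c, h, rfl⟩
    · simp only [kind, NodeKind.decision.injEq] at h
      obtain ⟨-, rfl⟩ := h
      rw [rank_mk _ _ _ p.1.1.2]
    · simp [kind] at h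
  have rank_trans : ∀ u v, Relation.TransGen (Edge kind) u v → rank u < rank v := by
    intro u v h
    induction h with
    | single h => have := rank_edge _ _ h; omega
    | tail _ h ih => have := rank_edge _ _ h; omega
  have trunc_zero : ∀ x, 0 ≤ (e x : ℕ) → (fun _ : V => false) x = false := fun _ _ => rfl
  have mk_congr : ∀ k g g' hg hg', g = g' → mk k g hg = mk k g' hg' := by
    rintro k g g' hg hg' rfl
    rfl
  have mk_pred : ∀ k g (hg : ∀ x, k + 1 ≤ (e x : ℕ) → g x = false), k < n →
      ∃ u, Edge kind u (mk (k + 1) g hg) := by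
    intro k g hg hk
    have h0 : ∀ x, (⟨k, hk⟩ : Fin n) ≤ e x →
        Function.update g (e.symm ⟨k, hk⟩) false x = false := by
      intro x hx
      by_cases hx' : x = e.symm ⟨k, hk⟩
      · subst hx'; simp
      · rw [Function.update_of_ne hx']
        refine hg x ?_
        have h1 : (e x : ℕ) ≠ k := by
          intro h
          exact hx' (by rw [Equiv.eq_symm_apply]; exact Fin.ext h)
        rw [Fin.le_def] at hx
        simp only at hx
        omega
    refine ⟨.inl ⟨(⟨k, hk⟩, Function.update g (e.symm ⟨k, hk⟩) false), h0⟩, _, _,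
      g (e.symm ⟨k, hk⟩), rfl, ?_⟩
    refine mk_congr _ _ _ _ _ (funext fun x => ?_)
    by_cases hx : x = e.symm ⟨k, hk⟩
    · subst hx; simp
    · simp [Function.update_of_ne hx]
  have mk_surj : ∀ v : N, ∃ k g hg, k ≤ n ∧ v = mk k g hg := by
    rintro (p | ⟨b, β, rfl⟩)
    · exact ⟨p.1.1, p.1.2, fun x hx => p.2 x hx, p.1.1.2.le, by simp [mk]⟩
    · exact ⟨n, β, fun x hx => absurd (e x).2 (by omega), le_rfl, by simp [mk]⟩
  refine ⟨_, ⟨N, inferInstance, kind, fun u h => lt_irrefl _ (rank_trans u u h), ?_,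
    mk 0 (fun _ => false) trunc_zero, ?_⟩, ⟨LinearOrder.lift' e e.injective, ?_⟩, ?_, rfl⟩
  · rintro b (p | c) (q | d) hu hv
    · simp [kind] at hu
    · simp [kind] at hu
    · simp [kind] at hv
    · simp only [kind, NodeKind.sink.injEq] at hu hv
      exact congrArg Sum.inr (Subtype.ext (hu.trans hv.symm))
  · intro v
    constructor
    · intro h
      obtain ⟨k, g, hg, hk, rfl⟩ := mk_surj v
      cases k with
      | zero =>
        have : g = fun _ => false := funext fun x => hg x (Nat.zero_le _)
        subst this
        rfl
      | succ k => exact absurd (mk_pred k g hg hk) h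
    · rintro rfl ⟨u, h⟩
      have := rank_edge _ _ h
      rw [rank_mk _ _ _ (Nat.zero_le n)] at this
      omega
  · rintro (p | b) (q | c) x y cu cv hu hv h
    · have hr := rank_edge _ _ h
      simp only [kind, NodeKind.decision.injEq] at hu hv
      obtain ⟨rfl, -⟩ := hu
      obtain ⟨rfl, -⟩ := hv
      change e (e.symm _) < e (e.symm _)
      simp only [Equiv.apply_symm_apply, Fin.lt_def]
      simp only [rank] at hr
      omega
    · simp [kind] at hv
    · simp [kind] at hu
    · simp [kind] at hu
  · intro β
    have htr : ∀ k x, k ≤ (e x : ℕ) → (if (e x : ℕ) < k then β x else false) = false := by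
      intro k x h
      rw [if_neg (by omega)]
    have key : ∀ k, k ≤ n → Relation.ReflTransGen
        (fun u v => ∃ (x : V) (child : Bool → N), kind u = .decision x child ∧ child (β x) = v)
        (mk 0 (fun _ => false) trunc_zero)
        (mk k (fun x => if (e x : ℕ) < k then β x else false) (htr k)) := by
      intro k
      induction k with
      | zero => intro _; simp only [Nat.not_lt_zero, if_false]; exact .refl
      | succ k ih =>
        intro hk
        refine (ih (by omega)).tail ⟨e.symm ⟨k, hk⟩, fun b => mk (k + 1)
          (Function.update (fun x => if (e x : ℕ) < k then β x else false)
            (e.symm ⟨k, hk⟩) b) (upd ⟨k, hk⟩ _ (fun x hx => htr k x hx) b), ?_, ?_⟩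
        · simp [mk, Nat.lt_of_succ_le hk, kind]
        · refine mk_congr _ _ _ _ _ (funext fun x => ?_)
          by_cases hx : x = e.symm ⟨k, hk⟩
          · subst hx; simp
          · have h1 : (e x : ℕ) ≠ k := by
              intro h
              exact hx (by rw [Equiv.eq_symm_apply]; exact Fin.ext h)
            rw [Function.update_of_ne hx]
            have : (e x : ℕ) < k ↔ (e x : ℕ) < k + 1 := by omega
            simp only [this]
    refine ⟨_, key n le_rfl, ?_⟩
    simp [mk, kind]

/-! ### Graphs -/

open Classical in
/-- The open neighborhood of a set `W` of vertices. -/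
noncomputable def neigh {V : Type} [Fintype V] (G : SimpleGraph V) (W : Finset V) : Finset V :=
  Finset.univ.filter (fun v => v ∉ W ∧ ∃ w ∈ W, G.Adj v w)

open Classical in
/-- `(n, d, a)`-expanders, for integers `n ≥ 1`, `d ≥ 3` and a real `0 < a < 1`. -/
def IsExpander {V : Type} [Fintype V] (G : SimpleGraph V) (n d : ℕ) (a : ℝ) : Prop :=
  1 ≤ n ∧ 3 ≤ d ∧ 0 < a ∧ a < 1 ∧
    Fintype.card V = n ∧ (∀ v : V, G.degree v ≤ d) ∧
    ∀ W : Finset V, (W.card : ℝ) ≤ (n : ℝ) / 2 → a * (W.card : ℝ) ≤ ((neigh G W).card : ℝ)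

/-- `F` is the graph CNF of `G`: the graph `G` has no isolated vertices, and the clauses of `F` are
the clauses `u ∨ v` for the edges `uv` of `G`. -/
def IsGraphCNFOf {X : Type} [DecidableEq X] (F : CNF X) {V : Finset X} (G : SimpleGraph V) : Prop :=
  (∀ v : V, ∃ w : V, G.Adj v w) ∧
    ∀ C : Clause X, C ∈ F.clauses ↔
      ∃ u v : V, G.Adj u v ∧ C = {((u : X), true), ((v : X), true)}

end OBDDLower

/-! Lower bound. Fix an OBDD and let `W` be the first half of its variable order. Expansion gives
linearly many vertices outside `W` with a neighbor in `W`. Bounded degree allows a constant fraction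
`S` of them to be selected, with distinct partners `f v ∈ W` that are pairwise nonadjacent and not
adjacent to other members of `S` (`exists_private_neighbors`). For `T ⊆ S`, set exactly `f(T)` to
false. If `v ∈ T \ T'`, also setting `v` to false uncovers the edge between `v` and `f v` for `T`,
while for `T'` the false vertices form an independent set and the formula stays true. So the `2 ^
|S|` assignments of `W` induce different subfunctions and must leave `W` at different nodes
(`BDD.card_le_size_of_fooling`, `two_pow_le_size`). At degree three the formula size is linear in
the number of vertices, so the bound is exponential in it.

Expanders. Join two copies of `m` points by the identity and two permutations. Such a graph expands
once every nonempty set of at most half of the points is moved noticeably by one of the two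
(`card_le_card_neigh_permGraph`). Such permutations exist by a union bound: a fixed `s`-set is
almost fixed by both with probability at most `√(s/m) ^ s / C(m, s)`, so all `s`-sets together
contribute at most `√(s/m) ^ s`, and the sum of this over `1 ≤ s ≤ m/2` tends to zero
(`card_near_sq_le`, `tendsto_sum_sqrt_pow`). -/

namespace OBDDLower

/-! ### Greedy independent sets -/

/-- A symmetric relation with at most `k` related elements per element has an independent set that
contains at least a `1 / (k + 1)` fraction of the elements. -/
theorem exists_independent_subset {α : Type*} [DecidableEq α] (A : Finset α) (R : α → α → Prop)
    [DecidableRel R] (hR : ∀ x y, R x y → R y x) (k : ℕ)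
    (hk : ∀ x ∈ A, (A.filter (R x)).card ≤ k) :
    ∃ S ⊆ A, (∀ x ∈ S, ∀ y ∈ S, x ≠ y → ¬ R x y) ∧ A.card ≤ S.card * (k + 1) := by
  obtain ⟨S, hS, hmax⟩ := Finset.exists_max_image
    (A.powerset.filter fun S => ∀ x ∈ S, ∀ y ∈ S, x ≠ y → ¬ R x y) Finset.card
    ⟨∅, by simp⟩
  simp only [Finset.mem_filter, Finset.mem_powerset] at hS hmax
  refine ⟨S, hS.1, hS.2, ?_⟩
  -- `S` is a largest independent set, so a point outside all these closed neighborhoods could be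
  -- added to it.
  have hcov : A ⊆ S.biUnion fun x => insert x (A.filter (R x)) := by
    intro y hy
    simp only [Finset.mem_biUnion, Finset.mem_insert, Finset.mem_filter]
    by_contra! h
    have hyS : y ∉ S := fun h' => (h y h').1 rfl
    have := hmax (insert y S) ⟨Finset.insert_subset hy hS.1, by
      intro a ha b hb hab
      rw [Finset.mem_insert] at ha hb
      rcases ha with rfl | ha <;> rcases hb with rfl | hb
      · exact absurd rfl hab
      · exact fun hr => (h b hb).2 hy (hR _ _ hr)
      · exact fun hr => (h a ha).2 hy hr
      · exact hS.2 a ha b hb hab⟩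
    rw [Finset.card_insert_of_notMem hyS] at this
    omega
  refine (Finset.card_le_card hcov).trans (Finset.card_biUnion_le_card_mul _ _ _ fun x hx => ?_)
  exact (Finset.card_insert_le _ _).trans (Nat.succ_le_succ (hk x (hS.1 hx)))

/-! ### Paths in ordered decision diagrams -/

namespace BDD

variable {V : Type} (D : BDD V)

/-- The node `p` is a sink or is labelled by a variable outside `W`. -/
def Leaves (W : Finset V) (p : D.Node) : Prop :=
  ∀ x child, D.kind p = .decision x child → x ∉ W

variable {D}

theorem activeEdge_rightUnique (β : V → Bool) :
    Relator.RightUnique (D.ActiveEdge β) := by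
  rintro u v w ⟨x, c, h, rfl⟩ ⟨y, d, h', rfl⟩
  rw [h] at h'
  simp only [NodeKind.decision.injEq] at h'
  obtain ⟨rfl, rfl⟩ := h'
  rfl

theorem eq_of_reflTransGen_sink {β : V → Bool} {t u : D.Node} {b : Bool}
    (ht : D.kind t = .sink b) (h : Relation.ReflTransGen (D.ActiveEdge β) t u) : u = t := by
  rcases h.cases_head with h | ⟨v, ⟨x, c, hx, -⟩, -⟩
  · exact h.symm
  · rw [ht] at hx
    cases hx

theorem reflTransGen_sink_unique {β : V → Bool} {u s t : D.Node} {a b : Bool}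
    (hs : D.kind s = .sink a) (ht : D.kind t = .sink b)
    (hus : Relation.ReflTransGen (D.ActiveEdge β) u s)
    (hut : Relation.ReflTransGen (D.ActiveEdge β) u t) : a = b := by
  have : s = t := by
    rcases hus.total_of_right_unique (activeEdge_rightUnique β) hut with h | h
    · exact (eq_of_reflTransGen_sink hs h).symm
    · exact eq_of_reflTransGen_sink ht h
  subst this
  rw [hs] at ht
  cases ht
  rfl

/-- The first node outside the prefix `W` on a computation path depends only on the values of the
variables in `W`. -/
theorem exists_leaves (W : Finset V) {β : V → Bool} {u t : D.Node} {b : Bool}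
    (ht : D.kind t = .sink b) (h : Relation.ReflTransGen (D.ActiveEdge β) u t) :
    ∃ p, D.Leaves W p ∧ ∀ γ : V → Bool, (∀ x ∈ W, γ x = β x) →
      Relation.ReflTransGen (D.ActiveEdge γ) u p := by
  induction h using Relation.ReflTransGen.head_induction_on with
  | refl =>
    refine ⟨t, fun x c hx => ?_, fun _ _ => .refl⟩
    rw [ht] at hx
    cases hx
  | @head u v huv _ ih =>
    obtain ⟨x, c, hx, rfl⟩ := huv
    by_cases hW : x ∈ W
    · obtain ⟨p, hp, hpath⟩ := ih
      exact ⟨p, hp, fun γ hγ => (hpath γ hγ).head ⟨x, c, hx, by rw [hγ x hW]⟩⟩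
    · refine ⟨u, fun y d hy => ?_, fun _ _ => .refl⟩
      rw [hx] at hy
      cases hy
      exact hW

/-- In an ordered diagram, a computation that has left the prefix `W` does not query it again. -/
theorem reflTransGen_congr_of_leaves {σ : LinearOrder V} (hD : D.IsOrderedBy σ) {W : Finset V}
    (hW : ∀ x y, y ∈ W → σ.lt x y → x ∈ W) {β γ : V → Bool} (hβγ : ∀ x ∉ W, γ x = β x)
    {p t : D.Node} (hp : D.Leaves W p) (h : Relation.ReflTransGen (D.ActiveEdge β) p t) :
    Relation.ReflTransGen (D.ActiveEdge γ) p t := by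
  induction h using Relation.ReflTransGen.head_induction_on with
  | refl => exact .refl
  | @head u v huv _ ih =>
    obtain ⟨x, c, hx, rfl⟩ := huv
    refine (ih fun y d hy hyW => ?_).head ⟨x, c, hx, by rw [hβγ x (hp x c hx)]⟩
    -- If the next variable `y` were in the initial segment `W`, its predecessor `x` would be too,
    -- but `x` lies outside.
    exact hp x c hx (hW x y hyW (hD _ _ x y c d hx hy ⟨x, c, _, hx, rfl⟩))

/-- Both computations pass through `p`, and from there only variables outside `W` are queried, on
which the two assignments agree; hence they end in the same sink. -/
theorem computes_congr_of_leaves {σ : LinearOrder V} (hD : D.IsOrderedBy σ) {W : Finset V}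
    (hW : ∀ x y, y ∈ W → σ.lt x y → x ∈ W) {f : (V → Bool) → Bool} (hf : D.Computes f)
    {β γ : V → Bool} (hβγ : ∀ x ∉ W, γ x = β x) {p : D.Node} (hp : D.Leaves W p)
    (hβ : Relation.ReflTransGen (D.ActiveEdge β) D.source p)
    (hγ : Relation.ReflTransGen (D.ActiveEdge γ) D.source p) : f β = f γ := by
  obtain ⟨s, hs, hs'⟩ := hf β
  obtain ⟨t, ht, ht'⟩ := hf γ
  have hps : Relation.ReflTransGen (D.ActiveEdge β) p s := by
    rcases hs.total_of_right_unique (activeEdge_rightUnique β) hβ with h | h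
    · rw [eq_of_reflTransGen_sink hs' h]
    · exact h
  exact reflTransGen_sink_unique hs' ht'
    (hγ.trans (reflTransGen_congr_of_leaves hD hW hβγ hp hps)) ht

/-- If the assignments `β i` lead to pairwise different subfunctions after the variables in the
prefix `W` have been queried, then the diagram has at least as many nodes as there are `i`. -/
theorem card_le_size_of_fooling {σ : LinearOrder V} (hD : D.IsOrderedBy σ) {W : Finset V}
    (hW : ∀ x y, y ∈ W → σ.lt x y → x ∈ W) {f : (V → Bool) → Bool} (hf : D.Computes f)
    {ι : Type*} [Finite ι] (β : ι → V → Bool)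
    (hβ : ∀ i j, i ≠ j → ∃ γ δ : V → Bool, (∀ x ∈ W, γ x = β i x) ∧ (∀ x ∈ W, δ x = β j x) ∧
      (∀ x ∉ W, δ x = γ x) ∧ f γ ≠ f δ) :
    Nat.card ι ≤ D.size := by
  have hex : ∀ i, ∃ p, D.Leaves W p ∧ ∀ γ : V → Bool, (∀ x ∈ W, γ x = β i x) →
      Relation.ReflTransGen (D.ActiveEdge γ) D.source p := fun i => by
    obtain ⟨t, ht, ht'⟩ := hf (β i)
    exact exists_leaves W ht' ht
  choose p hp hpath using hex
  have := D.finite_node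
  -- Each index goes to the node at which its computation leaves `W`; a shared node would identify
  -- two subfunctions that `hβ` separates.
  refine Nat.card_le_card_of_injective p fun i j hij => ?_
  by_contra hne
  obtain ⟨γ, δ, hγ, hδ, hγδ, hfγ⟩ := hβ i j hne
  exact hfγ (computes_congr_of_leaves hD hW hf hγδ (hp i) (hpath i γ hγ)
    (hij ▸ hpath j δ hδ))

end BDD

/-! ### The lower bound for graph CNFs -/

/-- In every linear order there is an initial segment of each possible size. -/
theorem exists_initial_segment {V : Type} [Fintype V] (σ : LinearOrder V) (k : ℕ)
    (hk : k ≤ Fintype.card V) :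
    ∃ W : Finset V, W.card = k ∧ ∀ x y, y ∈ W → σ.lt x y → x ∈ W := by
  let := σ
  let e : Fin (Fintype.card V) ≃o V := Fintype.orderIsoFinOfCardEq V rfl
  refine ⟨(Finset.univ.filter fun i : Fin (Fintype.card V) => (i : ℕ) < k).map
    e.toEquiv.toEmbedding, ?_, ?_⟩
  · rw [Finset.card_map, Fin.card_filter_val_lt, min_eq_right hk]
  · intro x y hy hxy
    simp only [Finset.mem_map_equiv, Finset.mem_filter, Finset.mem_univ, true_and] at hy ⊢
    have : e.symm x < e.symm y := e.symm.lt_iff_lt.2 hxy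
    exact lt_trans this hy

open Classical in
/-- From the outer boundary of `W` in a graph of maximum degree at most three, one can select a
constant fraction of the vertices together with neighbors in `W` that form an independent set and
are private. -/
theorem exists_private_neighbors {V : Type} [Fintype V] (G : SimpleGraph V)
    (hdeg : ∀ v, G.degree v ≤ 3) (W : Finset V) :
    ∃ (S : Finset V) (f : V → V), (neigh G W).card ≤ S.card * 22 ∧
      (∀ v ∈ S, v ∉ W ∧ f v ∈ W ∧ G.Adj v (f v)) ∧
      ∀ v ∈ S, ∀ w ∈ S, v ≠ w → f v ≠ f w ∧ ¬ G.Adj (f v) (f w) ∧ ¬ G.Adj (f v) w := by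
  have hex : ∀ v, ∃ w, v ∈ neigh G W → w ∈ W ∧ G.Adj v w := by
    intro v
    by_cases h : v ∈ neigh G W
    · obtain ⟨-, -, w, hw, hvw⟩ := Finset.mem_filter.1 h
      exact ⟨w, fun _ => ⟨hw, hvw⟩⟩
    · exact ⟨v, fun h' => absurd h' h⟩
  choose f hf using hex
  -- The conflicts to be avoided; the last disjunct makes the relation symmetric.
  let R : V → V → Prop := fun v w =>
    f v = f w ∨ G.Adj (f v) (f w) ∨ G.Adj (f v) w ∨ G.Adj (f w) v
  have hnb : ∀ x, ((G.neighborFinset x).biUnion fun y => G.neighborFinset y).card ≤ 9 := fun x =>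
    (Finset.card_biUnion_le_card_mul _ _ 3 fun y _ => hdeg y).trans
      (by have := hdeg x; rw [SimpleGraph.card_neighborFinset_eq_degree]; omega)
  obtain ⟨S, hS, hind, hcard⟩ := exists_independent_subset (neigh G W) R
    (by
      rintro v w (h | h | h | h)
      · exact .inl h.symm
      · exact .inr (.inl h.symm)
      · exact .inr (.inr (.inr h))
      · exact .inr (.inr (.inl h))) 21 (by
      intro v hv
      -- Since `w` is adjacent to `f w`, each conflict puts `w` within two steps of `f v` or of `v`:
      -- at most `3 + 9 + 9 = 21` candidates.
      have hsub : (neigh G W).filter (R v) ⊆ G.neighborFinset (f v) ∪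
          (((G.neighborFinset (f v)).biUnion fun y => G.neighborFinset y) ∪
            ((G.neighborFinset v).biUnion fun y => G.neighborFinset y)) := by
        intro w hw
        obtain ⟨hw, hR⟩ := Finset.mem_filter.1 hw
        have hww := (hf w hw).2
        simp only [Finset.mem_union, Finset.mem_biUnion, SimpleGraph.mem_neighborFinset]
        rcases hR with h | h | h | h
        · exact .inl (h ▸ hww.symm)
        · exact .inr (.inl ⟨_, h, hww.symm⟩)
        · exact .inl h
        · exact .inr (.inr ⟨_, h.symm, hww.symm⟩)
      refine (Finset.card_le_card hsub).trans ((Finset.card_union_le _ _).trans ?_)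
      have h1 := hdeg (f v)
      have h2 := Finset.card_union_le ((G.neighborFinset (f v)).biUnion fun y => G.neighborFinset y)
        ((G.neighborFinset v).biUnion fun y => G.neighborFinset y)
      have h3 := hnb (f v)
      have h4 := hnb v
      rw [SimpleGraph.card_neighborFinset_eq_degree]
      omega)
  refine ⟨S, f, hcard, fun v hv => ⟨(Finset.mem_filter.1 (hS hv)).2.1, hf v (hS hv)⟩,
    fun v hv w hw hvw => ?_⟩
  have := hind v hv w hw hvw
  simp only [R, not_or] at this
  exact ⟨this.1, this.2.1, this.2.2.1⟩

/-- The OBDDs that decide whether an assignment is a vertex cover of an expander of maximum degree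
at most three have exponential size. -/
theorem two_pow_le_size {V : Type} [Fintype V] (G : SimpleGraph V) {n : ℕ} {a : ℝ}
    (hG : IsExpander G n 3 a) {φ : (V → Bool) → Bool}
    (hφ : ∀ β, φ β = true ↔ ∀ u v, G.Adj u v → β u = true ∨ β v = true)
    {D : BDD V} (hD : D.IsOBDD) (hDφ : D.Computes φ) :
    ∃ s : ℕ, a * (n / 2 : ℕ) ≤ s * 22 ∧ 2 ^ s ≤ D.size := by
  classical
  obtain ⟨-, -, -, -, hn, hdeg, hexp⟩ := hG
  obtain ⟨σ, hσ⟩ := hD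
  obtain ⟨W, hWn, hW⟩ := exists_initial_segment σ (n / 2) (by omega)
  obtain ⟨S, f, hS, hSf, hpriv⟩ := exists_private_neighbors G (fun v => by convert hdeg v) W
  refine ⟨S.card, ?_, ?_⟩
  · have h1 := hexp W (by rw [hWn]; exact Nat.cast_div_le)
    rw [hWn] at h1
    exact h1.trans (by exact_mod_cast hS)
  -- The false vertices are `f(T) ∪ {v}`, which contains the edge from `v` to `f v`, and `f(T') ∪
  -- {v}`, which is independent because `v ∉ T'`.
  have key : ∀ T T' : Finset V, T ⊆ S → T' ⊆ S → ∀ v ∈ T, v ∉ T' →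
      φ (fun x => !decide (x ∈ T.image f ∨ x = v)) ≠
        φ (fun x => !decide (x ∈ T'.image f ∨ x = v)) := by
    intro T T' hT hT' v hv hv'
    have h1 : φ (fun x => !decide (x ∈ T'.image f ∨ x = v)) = true := by
      rw [hφ]
      intro x y hxy
      by_contra! hcon
      simp only [ne_eq, Bool.not_eq_true, Bool.not_eq_false', decide_eq_true_eq,
        Finset.mem_image] at hcon
      obtain ⟨⟨b, hb, rfl⟩ | rfl, ⟨c, hc, rfl⟩ | rfl⟩ := hcon
      · by_cases hbc : b = c
        · subst hbc
          exact G.loopless.irrefl _ hxy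
        · exact (hpriv b (hT' hb) c (hT' hc) hbc).2.1 hxy
      · exact (hpriv b (hT' hb) y (hT hv) (by rintro rfl; exact hv' hb)).2.2 hxy
      · exact (hpriv c (hT' hc) x (hT hv) (by rintro rfl; exact hv' hc)).2.2 hxy.symm
      · exact G.loopless.irrefl _ hxy
    rw [h1]
    intro h2
    rw [hφ] at h2
    have h3 := h2 v (f v) (hSf v (hT hv)).2.2
    simp [Finset.mem_image_of_mem f hv] at h3
  have hcard := BDD.card_le_size_of_fooling (ι := S.powerset) hσ hW hDφ
    (fun T x => !decide (x ∈ T.1.image f)) (by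
      -- As `v ∉ W`, making `v` false does not affect the prefix; as `f` maps `S` into `W`, the
      -- choice of `T` does not affect the rest.
      have hin : ∀ T : Finset V, ∀ v ∈ S, ∀ x ∈ W,
          (!decide (x ∈ T.image f ∨ x = v)) = !decide (x ∈ T.image f) := by
        intro T v hv x hx
        have : x ≠ v := by rintro rfl; exact (hSf x hv).1 hx
        simp [this]
      have hout : ∀ T T' : Finset V, T ⊆ S → T' ⊆ S → ∀ v, ∀ x ∉ W,
          (!decide (x ∈ T.image f ∨ x = v)) = !decide (x ∈ T'.image f ∨ x = v) := by
        intro T T' hT hT' v x hx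
        have h : ∀ T ⊆ S, x ∉ T.image f := by
          intro T hT h
          obtain ⟨w, hw, rfl⟩ := Finset.mem_image.1 h
          exact hx (hSf w (hT hw)).2.1
        simp [h T hT, h T' hT', -Finset.mem_image]
      rintro ⟨T, hT⟩ ⟨T', hT'⟩ hne
      rw [Finset.mem_powerset] at hT hT'
      have hne' : T ≠ T' := fun h => hne (Subtype.ext h)
      by_cases hsub : T ⊆ T'
      · obtain ⟨v, hv, hv'⟩ := Finset.exists_of_ssubset (hsub.ssubset_of_ne hne')
        exact ⟨fun x => !decide (x ∈ T.image f ∨ x = v), fun x => !decide (x ∈ T'.image f ∨ x = v),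
          hin T v (hT' hv), hin T' v (hT' hv), hout T' T hT' hT v, (key T' T hT' hT v hv hv').symm⟩
      · obtain ⟨v, hv, hv'⟩ := Finset.not_subset.1 hsub
        exact ⟨fun x => !decide (x ∈ T.image f ∨ x = v), fun x => !decide (x ∈ T'.image f ∨ x = v),
          hin T v (hT hv), hin T' v (hT hv), hout T' T hT' hT v, key T T' hT hT' v hv hv'⟩)
  rwa [Nat.card_eq_fintype_card, Fintype.card_coe, Finset.card_powerset] at hcard


/-! ### Random permutations rarely almost fix a set -/

section Counting

open Finset Filter Topology

variable {α : Type*} [Fintype α] [DecidableEq α]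

theorem exists_perm_map_eq {X Y : Finset α} (h : X.card = Y.card) :
    ∃ τ : Equiv.Perm α, X.map τ.toEmbedding = Y := by
  let e : {x // x ∈ X} ≃ {x // x ∈ Y} := X.equivOfCardEq h
  refine ⟨e.extendSubtype, Finset.eq_of_subset_of_card_le (fun y hy => ?_) ?_⟩
  · obtain ⟨x, hx, rfl⟩ := Finset.mem_map.1 hy
    exact e.extendSubtype_mem x hx
  · rw [Finset.card_map, h]

/-- The image of a set `X` under a random permutation is uniformly distributed among the sets of
the same size. -/
theorem card_perm_map_mem_mul_choose (X : Finset α) (𝒴 : Finset (Finset α))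
    (h𝒴 : ∀ Y ∈ 𝒴, Y.card = X.card) :
    (univ.filter fun π : Equiv.Perm α => X.map π.toEmbedding ∈ 𝒴).card *
      (Fintype.card α).choose X.card = 𝒴.card * (Fintype.card α).factorial := by
  -- Left multiplication by a permutation taking `X` to `Y` is a bijection between the two fibers.
  have hconst : ∀ Y : Finset α, Y.card = X.card →
      (univ.filter fun π : Equiv.Perm α => X.map π.toEmbedding = Y).card =
        (univ.filter fun π : Equiv.Perm α => X.map π.toEmbedding = X).card := by
    intro Y hY
    obtain ⟨τ, hτ⟩ := exists_perm_map_eq hY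
    refine Finset.card_bij (fun π _ => τ * π) ?_ (fun _ _ _ _ h => mul_left_cancel h) ?_
    · intro π hπ
      simp only [mem_filter, mem_univ, true_and] at hπ ⊢
      have h1 : X.map (τ * π).toEmbedding = (X.map π.toEmbedding).map τ.toEmbedding := by
        rw [Finset.map_map]
        rfl
      rw [h1, hπ, hτ]
    · intro π hπ
      simp only [mem_filter, mem_univ, true_and] at hπ
      refine ⟨τ⁻¹ * π, ?_, by simp⟩
      simp only [mem_filter, mem_univ, true_and]
      have h1 : X.map (τ⁻¹ * π).toEmbedding =
          (X.map π.toEmbedding).map (τ⁻¹ : Equiv.Perm α).toEmbedding := by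
        rw [Finset.map_map]
        rfl
      rw [h1, hπ]
      nth_rewrite 1 [← hτ]
      rw [Finset.map_map]
      ext y
      simp
  have hfib : ∀ 𝒵 : Finset (Finset α), (∀ Y ∈ 𝒵, Y.card = X.card) →
      (univ.filter fun π : Equiv.Perm α => X.map π.toEmbedding ∈ 𝒵).card =
        𝒵.card * (univ.filter fun π : Equiv.Perm α => X.map π.toEmbedding = X).card := by
    intro 𝒵 h𝒵
    rw [Finset.card_eq_sum_card_fiberwise (f := fun π : Equiv.Perm α => X.map π.toEmbedding)
      (t := 𝒵) (fun π hπ => by simpa using hπ), Finset.sum_const_nat]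
    intro Y hY
    rw [← hconst Y (h𝒵 Y hY), Finset.filter_filter]
    congr 1
    ext π
    simp only [mem_filter, mem_univ, true_and]
    exact ⟨fun h => h.2, fun h => ⟨h ▸ hY, h⟩⟩
  -- Taking all sets of this size determines the common fiber size: the fibers partition the whole
  -- symmetric group.
  have hall := hfib (powersetCard X.card univ) (by simp)
  rw [Finset.filter_true_of_mem (by simp), Finset.card_univ, Fintype.card_perm,
    Finset.card_powersetCard, Finset.card_univ] at hall
  rw [hfib 𝒴 h𝒴, hall]
  ring

/-- Chernoff-type bound on the number of sets of the size of `X` that almost coincide with `X`. -/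
theorem card_near_mul_pow_le (X : Finset α) (t : ℕ) {x y : ℝ} (hx : 0 ≤ x) (hx1 : x ≤ 1)
    (hy : 0 ≤ y) (hy1 : y ≤ 1) :
    (univ.filter fun Y : Finset α => Y.card = X.card ∧ (Y \ X).card ≤ t).card * (x * y) ^ t ≤
      (1 + x) ^ X.card * (1 + y) ^ (Fintype.card α - X.card) := by
  -- Points of `X` get weight `x`, all others weight `y`. The differences `X ∆ Y` are distinct sets;
  -- when `|Y| = |X|` and `|Y \ X| = k ≤ t`, the weight of the difference is `(x * y) ^ k ≥ (x * y)
  -- ^ t`.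
  have hw : ∀ A B : Finset α, A ⊆ X → Disjoint B X →
      ∏ i ∈ A ∪ B, (if i ∈ X then x else y) = x ^ A.card * y ^ B.card := by
    intro A B hA hB
    rw [Finset.prod_union (Finset.disjoint_of_subset_left hA hB.symm),
      Finset.prod_congr rfl fun i hi => if_pos (hA hi),
      Finset.prod_congr rfl fun i hi => if_neg (Finset.disjoint_left.1 hB hi)]
    simp
  have htot : (1 + x) ^ X.card * (1 + y) ^ (Fintype.card α - X.card) =
      ∑ S : Finset α, ∏ i ∈ S, (if i ∈ X then x else y) := by
    have h1 : ∏ i ∈ X, (1 + if i ∈ X then x else y) = (1 + x) ^ X.card := by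
      rw [Finset.prod_congr rfl fun i hi => by rw [if_pos hi], Finset.prod_const]
    have h2 : ∏ i ∈ univ \ X, (1 + if i ∈ X then x else y) =
        (1 + y) ^ (Fintype.card α - X.card) := by
      have h : ∀ i ∈ univ \ X, (1 + if i ∈ X then x else y) = 1 + y := fun i hi => by
        rw [if_neg (Finset.mem_sdiff.1 hi).2]
      rw [Finset.prod_congr rfl h, Finset.prod_const,
        Finset.card_sdiff_of_subset (Finset.subset_univ X), Finset.card_univ]
    rw [← Finset.powerset_univ, ← Finset.prod_one_add, ← Finset.prod_sdiff (Finset.subset_univ X),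
      h1, h2, mul_comm]
  rw [htot, ← nsmul_eq_mul, ← Finset.sum_const]
  calc ∑ _Y ∈ univ.filter (fun Y : Finset α => Y.card = X.card ∧ (Y \ X).card ≤ t), (x * y) ^ t
      ≤ ∑ Y ∈ univ.filter (fun Y : Finset α => Y.card = X.card ∧ (Y \ X).card ≤ t),
          ∏ i ∈ symmDiff X Y, (if i ∈ X then x else y) := by
        refine Finset.sum_le_sum fun Y hY => ?_
        obtain ⟨hc, ht⟩ := (Finset.mem_filter.1 hY).2
        have : symmDiff X Y = (X \ Y) ∪ (Y \ X) := rfl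
        rw [this, hw _ _ Finset.sdiff_subset Finset.sdiff_disjoint,
          Finset.card_sdiff_comm hc.symm, ← mul_pow]
        exact pow_le_pow_of_le_one (by positivity) (mul_le_one₀ hx1 hy hy1) ht
    _ = ∑ S ∈ (univ.filter (fun Y : Finset α => Y.card = X.card ∧ (Y \ X).card ≤ t)).image
          (symmDiff X), ∏ i ∈ S, (if i ∈ X then x else y) := by
        rw [Finset.sum_image fun Y _ Z _ h => symmDiff_right_injective X h]
    _ ≤ _ := Finset.sum_le_sum_of_subset_of_nonneg (Finset.subset_univ _) fun S _ _ =>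
        Finset.prod_nonneg fun i _ => by split_ifs <;> assumption

/-- Induction via `C(m+1, s+1) = (m+1)/(s+1) * C(m, s)`, together with `(m+1)/(s+1) ≤ m/s` for `0 <
s ≤ m`. -/
theorem div_pow_le_choose {m s : ℕ} (hs : s ≤ m) : ((m : ℝ) / s) ^ s ≤ m.choose s := by
  induction s generalizing m with
  | zero => simp
  | succ s ih =>
    obtain ⟨m, rfl⟩ : ∃ k, m = k + 1 := ⟨m - 1, by omega⟩
    have hsm : s ≤ m := by omega
    have h1 : ((m + 1).choose (s + 1) : ℝ) = ((m + 1 : ℕ) : ℝ) / ((s + 1 : ℕ) : ℝ) * m.choose s := by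
      rw [eq_comm, div_mul_eq_mul_div, div_eq_iff (by positivity)]
      exact_mod_cast Nat.add_one_mul_choose_eq m s
    rw [h1, pow_succ']
    refine mul_le_mul_of_nonneg_left (le_trans ?_ (ih hsm)) (by positivity)
    rcases Nat.eq_zero_or_pos s with rfl | hpos
    · simp
    refine pow_le_pow_left₀ (by positivity) ?_ s
    rw [div_le_div_iff₀ (by positivity) (by positivity)]
    have : (s : ℝ) ≤ m := by exact_mod_cast hsm
    push_cast
    nlinarith

/-- The square reflects the use of two independent permutations: dividing by `C(m, s) ^ 2` leaves
one factor `1 / C(m, s)` to pay for the union bound over all `s`-sets. With one permutation that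
bound would be the number of near sets, which is at least one. -/
theorem card_near_sq_le (X : Finset α) (hX : X.Nonempty) (hX2 : 2 * X.card ≤ Fintype.card α) :
    ((univ.filter fun Y : Finset α =>
      Y.card = X.card ∧ (Y \ X).card ≤ X.card / 200).card : ℝ) ^ 2 ≤
      (Fintype.card α).choose X.card * √((X.card : ℝ) / Fintype.card α) ^ X.card := by
  set m := Fintype.card α with hm
  set s := X.card with hs
  set N := (univ.filter fun Y : Finset α => Y.card = s ∧ (Y \ X).card ≤ s / 200).card with hN
  have hs0 : 0 < s := hX.card_pos
  have hs0' : (0 : ℝ) < s := by exact_mod_cast hs0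
  have hm0 : (0 : ℝ) < m := by exact_mod_cast (by omega : 0 < m)
  have hsm : 2 * (s : ℝ) ≤ m := by exact_mod_cast hX2
  set ℓ := Real.log (m / s) with hℓ
  have hr : (0 : ℝ) < m / s := by positivity
  have hℓ2 : Real.log 2 ≤ ℓ := Real.log_le_log (by norm_num) (by rwa [le_div_iff₀ hs0'])
  have hlog2 := Real.log_two_gt_d9
  have hexpℓ : (m : ℝ) / s = Real.exp ℓ := (Real.exp_log hr).symm
  have hbound := card_near_mul_pow_le X (s / 200) (x := 1 / 100) (y := s / m * (1 / 100))
    (by norm_num) (by norm_num) (by positivity) (by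
      have : (s : ℝ) / m ≤ 1 := by rw [div_le_one hm0]; linarith
      linarith)
  rw [← hs, ← hN, ← hm] at hbound
  clear_value N ℓ s m
  have h1 : (1 + 1 / 100 : ℝ) ^ s ≤ Real.exp (s * (1 / 100)) := by
    rw [Real.exp_nat_mul]
    exact pow_le_pow_left₀ (by norm_num) (by linarith [Real.add_one_le_exp (1 / 100 : ℝ)]) _
  have h2 : (1 + s / m * (1 / 100) : ℝ) ^ (m - s) ≤ Real.exp (s * (1 / 100)) := by
    have : (s : ℝ) * (1 / 100) = m * (s / m * (1 / 100)) := by field_simp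
    rw [this, Real.exp_nat_mul]
    have h : (1 : ℝ) ≤ 1 + s / m * (1 / 100) := by
      have : (0 : ℝ) ≤ s / m * (1 / 100) := by positivity
      linarith
    refine (pow_le_pow_right₀ h (Nat.sub_le m s)).trans ?_
    exact pow_le_pow_left₀ (by positivity)
      (by linarith [Real.add_one_le_exp (s / m * (1 / 100) : ℝ)]) _
  have h3 : Real.exp (-(s * (15 * ℓ / 200))) ≤ (1 / 100 * (s / m * (1 / 100)) : ℝ) ^ (s / 200) := by
    -- The right side is `exp(-ℓ) / 10000`, and `ℓ ≥ log 2` gives `exp(-14ℓ) ≤ 2⁻¹⁴ < 1 / 10000`.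
    have hbase : Real.exp (-(15 * ℓ)) ≤ 1 / 100 * (s / m * (1 / 100)) := by
      have hsm' : (s : ℝ) / m = Real.exp (-ℓ) := by
        rw [Real.exp_neg, ← hexpℓ, inv_div]
      have h14 : Real.exp (-(14 * ℓ)) ≤ 1 / 10000 := by
        have : Real.exp (-(14 * ℓ)) ≤ Real.exp (-((14 : ℕ) * Real.log 2)) :=
          Real.exp_le_exp.2 (by push_cast; linarith)
        refine this.trans ?_
        rw [Real.exp_neg, Real.exp_nat_mul, Real.exp_log (by norm_num)]
        norm_num
      have : -(15 * ℓ) = -(14 * ℓ) + -ℓ := by ring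
      rw [this, Real.exp_add, hsm']
      nlinarith [Real.exp_pos (-ℓ)]
    refine le_trans ?_ (pow_le_pow_left₀ (Real.exp_pos _).le hbase _)
    rw [← Real.exp_nat_mul, Real.exp_le_exp]
    have : ((s / 200 : ℕ) : ℝ) ≤ s / 200 := by exact_mod_cast Nat.cast_div_le (α := ℝ)
    nlinarith
  -- The exponent obtained is `s * (1/50 + 15ℓ/200)`, and `1/50 ≤ 7ℓ/40` because `ℓ ≥ log 2`.
  have hNle : (N : ℝ) ≤ Real.exp (s * (ℓ / 4)) := by
    have h4 : (N : ℝ) * Real.exp (-(s * (15 * ℓ / 200))) ≤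
        Real.exp (s * (1 / 100)) * Real.exp (s * (1 / 100)) :=
      (mul_le_mul_of_nonneg_left h3 (by positivity)).trans
        (hbound.trans (mul_le_mul h1 h2 (by positivity) (by positivity)))
    rw [← Real.exp_add, Real.exp_neg, ← div_eq_mul_inv, div_le_iff₀ (Real.exp_pos _),
      ← Real.exp_add] at h4
    refine h4.trans (Real.exp_le_exp.2 ?_)
    nlinarith
  have hsqrt : √((s : ℝ) / m) = Real.exp (-(ℓ / 2)) := by
    rw [Real.sqrt_eq_iff_mul_self_eq (by positivity) (Real.exp_pos _).le, ← Real.exp_add,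
      ← inv_div, hexpℓ, ← Real.exp_neg]
    ring_nf
  calc (N : ℝ) ^ 2 ≤ Real.exp (s * (ℓ / 4)) ^ 2 := pow_le_pow_left₀ (by positivity) hNle 2
    _ = ((m : ℝ) / s) ^ s * √((s : ℝ) / m) ^ s := by
      rw [hsqrt, hexpℓ, ← Real.exp_nat_mul, ← Real.exp_nat_mul, ← Real.exp_nat_mul, ← Real.exp_add]
      push_cast
      ring_nf
    _ ≤ _ := mul_le_mul_of_nonneg_right (div_pow_le_choose (by omega)) (by positivity)

/-- Dominated convergence: for fixed `s > 0` the term vanishes as `m` grows, and `2 * s ≤ m` bounds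
it by the summable `√(1/2) ^ s`. -/
theorem tendsto_sum_sqrt_pow :
    Tendsto (fun m : ℕ => ∑ s ∈ range (m + 1),
      if 0 < s ∧ 2 * s ≤ m then √((s : ℝ) / m) ^ s else 0) atTop (𝓝 0) := by
  have hsum : Summable fun s : ℕ => √(1 / 2 : ℝ) ^ s :=
    summable_geometric_of_lt_one (Real.sqrt_nonneg _) (by
      rw [Real.sqrt_lt' one_pos]; norm_num)
  have key := tendsto_tsum_of_dominated_convergence (𝓕 := atTop) (g := fun _ : ℕ => (0 : ℝ))
    (f := fun (m s : ℕ) => if 0 < s ∧ 2 * s ≤ m then √((s : ℝ) / m) ^ s else 0) hsum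
    (by
      intro s
      rcases Nat.eq_zero_or_pos s with rfl | hs
      · simp
      have h1 : Tendsto (fun m : ℕ => √((s : ℝ) / m) ^ s) atTop (𝓝 0) := by
        have h := ((Real.continuous_sqrt.tendsto 0).comp
          (tendsto_const_div_atTop_nhds_zero_nat (s : ℝ))).pow s
        rwa [Real.sqrt_zero, zero_pow hs.ne'] at h
      refine squeeze_zero (fun m => ?_) (fun m => ?_) h1
      · positivity
      · split_ifs
        · exact le_rfl
        · positivity)
    (by
      refine Eventually.of_forall fun m s => ?_
      split_ifs with h
      · rw [Real.norm_of_nonneg (by positivity)]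
        refine pow_le_pow_left₀ (Real.sqrt_nonneg _) (Real.sqrt_le_sqrt ?_) s
        have hs : (0 : ℝ) < s := by exact_mod_cast h.1
        have hm : 2 * (s : ℝ) ≤ m := by exact_mod_cast h.2
        rw [div_le_div_iff₀ (by linarith) (by norm_num)]
        linarith
      · rw [norm_zero]
        positivity)
  rw [tsum_zero] at key
  refine key.congr fun m => tsum_eq_sum fun s hs => if_neg ?_
  rw [Finset.mem_range] at hs
  omega

/-- For all large `m` there are two permutations of `m` points such that each nonempty set of at
most half of the points is moved considerably by one of them. -/
theorem eventually_exists_expanding_perms :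
    ∀ᶠ m : ℕ in atTop, ∃ p q : Equiv.Perm (Fin m), ∀ X : Finset (Fin m), X.Nonempty →
      2 * X.card ≤ m → X.card ≤ 200 * (X.map p.toEmbedding \ X).card ∨
        X.card ≤ 200 * (X.map q.toEmbedding \ X).card := by
  filter_upwards [tendsto_sum_sqrt_pow.eventually_lt_const one_pos] with m hm
  by_contra! hcon
  let bad : Finset (Fin m) → Finset (Equiv.Perm (Fin m)) := fun X =>
    univ.filter fun π => X.map π.toEmbedding ∈
      univ.filter fun Y : Finset (Fin m) => Y.card = X.card ∧ (Y \ X).card ≤ X.card / 200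
  let g : ℕ → ℝ := fun s => if 0 < s ∧ 2 * s ≤ m then √((s : ℝ) / m) ^ s else 0
  have hbad : ∀ X : Finset (Fin m), 0 < X.card ∧ 2 * X.card ≤ m →
      ((bad X).card : ℝ) ^ 2 ≤ (m.factorial : ℝ) ^ 2 * (g X.card / m.choose X.card) := by
    intro X hX
    have h1 := card_near_sq_le X (Finset.card_pos.1 hX.1) (by simpa using hX.2)
    have h2 := card_perm_map_mem_mul_choose X
      (univ.filter fun Y : Finset (Fin m) => Y.card = X.card ∧ (Y \ X).card ≤ X.card / 200)
      (fun Y hY => (Finset.mem_filter.1 hY).2.1)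
    rw [Fintype.card_fin] at h1 h2
    have hC : (0 : ℝ) < m.choose X.card := by
      exact_mod_cast Nat.choose_pos (by omega)
    have h3 : ((bad X).card : ℝ) * m.choose X.card =
        (univ.filter fun Y : Finset (Fin m) =>
          Y.card = X.card ∧ (Y \ X).card ≤ X.card / 200).card * (m.factorial : ℝ) := by
      exact_mod_cast h2
    have h4 : g X.card = √((X.card : ℝ) / m) ^ X.card := if_pos hX
    rw [h4, mul_div_assoc', le_div_iff₀ hC]
    refine le_of_mul_le_mul_right ?_ hC
    calc ((bad X).card : ℝ) ^ 2 * m.choose X.card * m.choose X.card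
        = (((bad X).card : ℝ) * m.choose X.card) ^ 2 := by ring
      _ ≤ _ := by
        rw [h3, mul_pow]
        nlinarith [sq_nonneg (m.factorial : ℝ)]
  -- If no pair works, every pair has a set `X` that is almost fixed by both, so the squares of the
  -- `bad X` cover all `(m!) ^ 2` pairs.
  have hcov : (univ : Finset (Equiv.Perm (Fin m) × Equiv.Perm (Fin m))) ⊆
      (univ.filter fun X : Finset (Fin m) => 0 < X.card ∧ 2 * X.card ≤ m).biUnion
        fun X => bad X ×ˢ bad X := by
    rintro ⟨p, q⟩ -
    obtain ⟨X, hX, hX2, hp, hq⟩ := hcon p q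
    simp only [bad, mem_biUnion, mem_filter, mem_univ, true_and, mem_product, card_map]
    exact ⟨X, ⟨hX.card_pos, hX2⟩, by omega, by omega⟩
  have hcount := (Finset.card_le_card hcov).trans Finset.card_biUnion_le
  rw [Finset.card_univ, Fintype.card_prod, Fintype.card_perm, Fintype.card_fin] at hcount
  have hcount' : (m.factorial : ℝ) * m.factorial ≤
      ∑ X ∈ univ.filter (fun X : Finset (Fin m) => 0 < X.card ∧ 2 * X.card ≤ m),
        ((bad X).card : ℝ) ^ 2 := by
    simp only [Finset.card_product] at hcount
    simp only [sq]
    exact_mod_cast hcount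
  have hsum : ∑ X ∈ univ.filter (fun X : Finset (Fin m) => 0 < X.card ∧ 2 * X.card ≤ m),
      ((bad X).card : ℝ) ^ 2 ≤ (m.factorial : ℝ) ^ 2 * ∑ s ∈ range (m + 1), g s := by
    refine (Finset.sum_le_sum fun X hX => hbad X (Finset.mem_filter.1 hX).2).trans ?_
    rw [← Finset.mul_sum]
    refine mul_le_mul_of_nonneg_left ?_ (by positivity)
    have hg : ∀ s, 0 ≤ g s := fun s => by
      simp only [g]
      positivity
    refine (Finset.sum_le_sum_of_subset_of_nonneg (Finset.filter_subset _ _) fun X _ _ =>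
      div_nonneg (hg _) (by positivity)).trans ?_
    -- Grouping the sets by size, the `C(m, s)` sets of size `s` cancel the denominator.
    rw [← Finset.powerset_univ,
      Finset.sum_powerset_apply_card (fun s => g s / (m.choose s : ℝ)), Finset.card_univ,
      Fintype.card_fin]
    refine Finset.sum_le_sum fun s hs => ?_
    rw [nsmul_eq_mul, mul_div_cancel₀]
    have : 0 < m.choose s := Nat.choose_pos (by rw [Finset.mem_range] at hs; omega)
    positivity
  have hf : (0 : ℝ) < m.factorial := by positivity
  have := mul_lt_mul_of_pos_left hm (show (0 : ℝ) < (m.factorial : ℝ) ^ 2 by positivity)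
  simp only [g] at hsum
  nlinarith

end Counting


/-! ### Expanders of maximum degree three -/

theorem mem_neigh {V : Type} [Fintype V] {G : SimpleGraph V} {W : Finset V} {v : V} :
    v ∈ neigh G W ↔ v ∉ W ∧ ∃ w ∈ W, G.Adj v w := by
  simp [neigh]

section Bipartite

open Finset

variable {α : Type} [DecidableEq α]

/-- The bipartite graph on two copies of `α` in which `i` on the left is joined to `i`, `p i` and
`q i` on the right. -/
def permGraph (p q : Equiv.Perm α) : SimpleGraph (α × Bool) where
  Adj x y :=
    (x.2 = false ∧ y.2 = true ∧ (y.1 = x.1 ∨ y.1 = p x.1 ∨ y.1 = q x.1)) ∨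
      (y.2 = false ∧ x.2 = true ∧ (x.1 = y.1 ∨ x.1 = p y.1 ∨ x.1 = q y.1))
  symm := ⟨fun _ _ h => h.symm⟩
  loopless := ⟨fun x h => by rcases h with ⟨h, h', -⟩ | ⟨h, h', -⟩ <;> simp [h] at h'⟩

/-- Applying `p` turns `p⁻¹X \ X` into `X \ pX`, which has as many elements as `pX \ X` because
`|pX| = |X|`. It makes the expansion symmetric in the two sides of the graph. -/
theorem card_map_symm_sdiff (p : Equiv.Perm α) (X : Finset α) :
    (X.map p.symm.toEmbedding \ X).card = (X.map p.toEmbedding \ X).card := by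
  rw [← Finset.card_map p.toEmbedding, Finset.map_sdiff, Finset.map_map]
  have : (p.symm.toEmbedding.trans p.toEmbedding) = Function.Embedding.refl α := by
    ext x
    simp
  rw [this, Finset.map_refl, Finset.card_sdiff_comm (Finset.card_map _).symm]

variable [Fintype α]

/-- Every nonempty set of at most half of the points is moved considerably by `p` or by `q`. -/
def ExpandingPerms (p q : Equiv.Perm α) : Prop :=
  ∀ X : Finset α, X.Nonempty → 2 * X.card ≤ Fintype.card α →
    X.card ≤ 200 * (X.map p.toEmbedding \ X).card ∨ X.card ≤ 200 * (X.map q.toEmbedding \ X).card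

theorem ExpandingPerms.symm {p q : Equiv.Perm α} (h : ExpandingPerms p q) :
    ExpandingPerms p.symm q.symm := fun X hX hX2 => by
  rw [card_map_symm_sdiff, card_map_symm_sdiff]
  exact h X hX hX2

theorem ExpandingPerms.card_le {p q : Equiv.Perm α} (h : ExpandingPerms p q) (X : Finset α)
    (hX : 2 * X.card ≤ Fintype.card α) :
    201 * X.card ≤ 200 * (X ∪ X.map p.toEmbedding ∪ X.map q.toEmbedding).card := by
  rcases X.eq_empty_or_nonempty with rfl | hne
  · simp
  have key : ∀ Y : Finset α, Y ⊆ X ∪ X.map p.toEmbedding ∪ X.map q.toEmbedding →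
      X.card + (Y \ X).card ≤ (X ∪ X.map p.toEmbedding ∪ X.map q.toEmbedding).card := by
    intro Y hY
    rw [← Finset.card_union_of_disjoint Finset.disjoint_sdiff]
    refine Finset.card_le_card (Finset.union_subset ?_ (Finset.sdiff_subset.trans hY))
    exact Finset.subset_union_left.trans Finset.subset_union_left
  have hp := key (X.map p.toEmbedding) (Finset.subset_union_right.trans Finset.subset_union_left)
  have hq := key (X.map q.toEmbedding) Finset.subset_union_right
  rcases h X hne hX with h | h <;> omega

open Classical in
theorem permGraph_degree_le (p q : Equiv.Perm α) (x : α × Bool) :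
    (permGraph p q).degree x ≤ 3 := by
  rw [← SimpleGraph.card_neighborFinset_eq_degree]
  obtain ⟨i, b⟩ := x
  cases b
  · have hsub : (permGraph p q).neighborFinset (i, false) ⊆ ({i, p i, q i} : Finset α) ×ˢ {true} := by
      rintro ⟨j, c⟩ hj
      rw [SimpleGraph.mem_neighborFinset] at hj
      simp only [permGraph, true_and, Bool.false_eq_true, and_false, false_and,
        or_false] at hj
      simpa [and_comm (b := c = true), hj.1] using hj.2
    refine (Finset.card_le_card hsub).trans ?_
    rw [Finset.card_product, Finset.card_singleton, mul_one]
    exact Finset.card_le_three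
  · have hsub : (permGraph p q).neighborFinset (i, true) ⊆
        ({i, p.symm i, q.symm i} : Finset α) ×ˢ {false} := by
      rintro ⟨j, c⟩ hj
      rw [SimpleGraph.mem_neighborFinset] at hj
      simp only [permGraph, true_and, reduceCtorEq, false_and, false_or] at hj
      have h : j = i ∨ j = p.symm i ∨ j = q.symm i := by
        simpa only [Equiv.eq_symm_apply, eq_comm (a := i)] using hj.2
      simpa [hj.1] using h
    refine (Finset.card_le_card hsub).trans ?_
    rw [Finset.card_product, Finset.card_singleton, mul_one]
    exact Finset.card_le_three

/-- Let `A` and `B` be the left and right parts of `W`. The smaller one has at most half of the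
points, so its neighborhood on the other side grows by the factor `201/200`; for the larger one the
identity edges still ensure that its neighborhood is no smaller than itself. -/
theorem card_le_card_neigh_permGraph {p q : Equiv.Perm α} (h : ExpandingPerms p q)
    (W : Finset (α × Bool)) (hW : W.card ≤ Fintype.card α) :
    W.card ≤ 600 * (neigh (permGraph p q) W).card := by
  set A : Finset α := univ.filter fun i => (i, false) ∈ W with hA
  set B : Finset α := univ.filter fun i => (i, true) ∈ W with hB
  have hWAB : W.card = A.card + B.card := by
    have h1 : W = A ×ˢ {false} ∪ B ×ˢ {true} := by
      ext ⟨i, b⟩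
      cases b <;> simp [hA, hB]
    have h2 : Disjoint (A ×ˢ {false}) (B ×ˢ {true}) :=
      Finset.disjoint_product.2 (.inr (by simp))
    rw [h1, Finset.card_union_of_disjoint h2]
    simp
  set NA := A ∪ A.map p.toEmbedding ∪ A.map q.toEmbedding with hNA
  set NB := B ∪ B.map p.symm.toEmbedding ∪ B.map q.symm.toEmbedding with hNB
  have hneigh : (NA \ B).card + (NB \ A).card ≤ (neigh (permGraph p q) W).card := by
    have h2 : Disjoint ((NA \ B) ×ˢ {true}) ((NB \ A) ×ˢ {false}) :=
      Finset.disjoint_product.2 (.inr (by simp))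
    have h3 : (NA \ B) ×ˢ {true} ∪ (NB \ A) ×ˢ {false} ⊆ neigh (permGraph p q) W := by
      rintro ⟨i, b⟩ hi
      rw [mem_neigh]
      cases b
      · have hi' : i ∈ NB \ A := by simpa using hi
        rw [Finset.mem_sdiff] at hi'
        refine ⟨by simpa [hA] using hi'.2, ?_⟩
        simp only [hNB, Finset.mem_union, Finset.mem_map_equiv, Equiv.symm_symm, hB,
          Finset.mem_filter, Finset.mem_univ, true_and] at hi'
        rcases hi'.1 with (h | h) | h
        · exact ⟨_, h, by simp [permGraph]⟩
        · exact ⟨_, h, by simp [permGraph]⟩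
        · exact ⟨_, h, by simp [permGraph]⟩
      · have hi' : i ∈ NA \ B := by simpa using hi
        rw [Finset.mem_sdiff] at hi'
        refine ⟨by simpa [hB] using hi'.2, ?_⟩
        simp only [hNA, Finset.mem_union, Finset.mem_map_equiv, hA,
          Finset.mem_filter, Finset.mem_univ, true_and] at hi'
        rcases hi'.1 with (h | h) | h
        · exact ⟨_, h, by simp [permGraph]⟩
        · exact ⟨_, h, by simp [permGraph]⟩
        · exact ⟨_, h, by simp [permGraph]⟩
    have := Finset.card_le_card h3
    rw [Finset.card_union_of_disjoint h2] at this
    simpa using this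
  have h1 : NA.card ≤ (NA \ B).card + B.card := by
    have := Finset.le_card_sdiff B NA
    omega
  have h2 : NB.card ≤ (NB \ A).card + A.card := by
    have := Finset.le_card_sdiff A NB
    omega
  have h3 : A.card ≤ NA.card :=
    Finset.card_le_card (Finset.subset_union_left.trans Finset.subset_union_left)
  have h4 : B.card ≤ NB.card :=
    Finset.card_le_card (Finset.subset_union_left.trans Finset.subset_union_left)
  -- If `|A| ≤ |B|` and `N` is the number of outside neighbors, then `N ≥ |NA| + |NB| - |A| - |B| ≥
  -- |A| / 200` and `N ≥ |NB| - |A| ≥ |B| - |A|`. Hence `|A| + |B| ≤ 401 * N`, within the bound 600.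
  rcases le_total A.card B.card with hAB | hAB
  · have := h.card_le A (by omega)
    rw [← hNA] at this
    omega
  · have := h.symm.card_le B (by omega)
    rw [← hNB] at this
    omega

theorem isExpander_permGraph [Nonempty α] {p q : Equiv.Perm α} (h : ExpandingPerms p q) :
    IsExpander (permGraph p q) (2 * Fintype.card α) 3 (1 / 600) := by
  have hpos : 0 < Fintype.card α := Fintype.card_pos
  refine ⟨by omega, le_rfl, by norm_num, by norm_num, ?_, fun v => by
    convert permGraph_degree_le p q v, fun W hW => ?_⟩
  · rw [Fintype.card_prod, Fintype.card_bool, mul_comm]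
  · have hW' : W.card ≤ Fintype.card α := by
      push_cast at hW
      rw [mul_div_cancel_left₀ _ two_ne_zero] at hW
      exact_mod_cast hW
    have : (W.card : ℝ) ≤ 600 * ((neigh (permGraph p q) W).card : ℝ) := by
      exact_mod_cast card_le_card_neigh_permGraph h W hW'
    linarith

end Bipartite

theorem IsExpander.comap_equiv {V V' : Type} [Fintype V] [Fintype V'] {G : SimpleGraph V'}
    {n d : ℕ} {a : ℝ} (h : IsExpander G n d a) (e : V ≃ V') : IsExpander (G.comap e) n d a := by
  classical
  obtain ⟨h1, h2, h3, h4, h5, h6, h7⟩ := h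
  refine ⟨h1, h2, h3, h4, (Fintype.card_congr e).trans h5, fun v => ?_, fun W hW => ?_⟩
  · refine le_of_eq_of_le ?_ (h6 (e v))
    exact ((SimpleGraph.Iso.comap e G).degree_eq v).symm
  · have h := h7 (W.map e.toEmbedding) (by rwa [Finset.card_map])
    have heq : neigh G (W.map e.toEmbedding) = (neigh (G.comap e) W).map e.toEmbedding := by
      ext v
      obtain ⟨v, rfl⟩ := e.surjective v
      have h := e.exists_congr_left (p := fun w => w ∈ W ∧ G.Adj (e v) (e w))
      simp only [Equiv.apply_symm_apply] at h
      simp [mem_neigh, h]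
    rwa [heq, Finset.card_map, Finset.card_map] at h

/-- In an expander with at least two vertices there are no isolated vertices. -/
theorem IsExpander.exists_adj {V : Type} [Fintype V] {G : SimpleGraph V} {n d : ℕ} {a : ℝ}
    (h : IsExpander G n d a) (hn : 2 ≤ n) (v : V) : ∃ w, G.Adj v w := by
  obtain ⟨-, -, ha, -, -, -, h⟩ := h
  have hn' : (2 : ℝ) ≤ n := by exact_mod_cast hn
  have h1 := h {v} (by rw [Finset.card_singleton]; push_cast; linarith)
  rw [Finset.card_singleton, Nat.cast_one, mul_one] at h1
  have h2 : 0 < (neigh G {v}).card := by exact_mod_cast ha.trans_le h1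
  obtain ⟨w, hw⟩ := Finset.card_pos.1 h2
  obtain ⟨-, u, hu, hwu⟩ := mem_neigh.1 hw
  rw [Finset.mem_singleton] at hu
  exact ⟨w, hu ▸ hwu.symm⟩

theorem exists_large_expander (N : ℕ) : ∃ (n : ℕ) (V : Finset ℕ) (G : SimpleGraph V),
    N ≤ n ∧ 2 ≤ n ∧ IsExpander G n 3 (1 / 600) := by
  obtain ⟨m, ⟨p, q, hpq⟩, hm⟩ :=
    (eventually_exists_expanding_perms.and (Filter.eventually_ge_atTop (N + 1))).exists
  have : Nonempty (Fin m) := ⟨⟨0, by omega⟩⟩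
  have hexp : ExpandingPerms p q := fun X hX hX2 => hpq X hX (by simpa using hX2)
  have hG := isExpander_permGraph hexp
  rw [Fintype.card_fin] at hG
  let e : Finset.range (2 * m) ≃ Fin m × Bool :=
    Fintype.equivOfCardEq (by simp [mul_comm])
  exact ⟨2 * m, Finset.range (2 * m), _, by omega, by omega, hG.comap_equiv e⟩

/-! ### Graph CNFs -/

open Classical in
/-- The graph CNF of a finite graph. -/
noncomputable def graphCNF {X : Type} [DecidableEq X] {V : Finset X} (G : SimpleGraph V) :
    CNF X where
  clauses := (Finset.univ.filter fun e : V × V => G.Adj e.1 e.2).image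
    fun e => {((e.1 : X), true), ((e.2 : X), true)}
  nontautological := by
    intro C hC x hx
    obtain ⟨e, -, rfl⟩ := Finset.mem_image.1 hC
    simp at hx

theorem isGraphCNFOf_graphCNF {X : Type} [DecidableEq X] {V : Finset X} {G : SimpleGraph V}
    (h : ∀ v : V, ∃ w : V, G.Adj v w) : IsGraphCNFOf (graphCNF G) G := by
  refine ⟨h, fun C => ?_⟩
  simp only [graphCNF, Finset.mem_image, Finset.mem_filter, Finset.mem_univ, true_and,
    Prod.exists]
  exact ⟨fun ⟨u, v, huv, hC⟩ => ⟨u, v, huv, hC.symm⟩, fun ⟨u, v, huv, hC⟩ => ⟨u, v, huv, hC.symm⟩⟩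

namespace IsGraphCNFOf

variable {X : Type} [DecidableEq X] {F : CNF X} {V : Finset X} {G : SimpleGraph V}

theorem isMonotone (h : IsGraphCNFOf F G) : F.IsMonotone := by
  intro C hC l hl
  obtain ⟨u, v, -, rfl⟩ := (h.2 C).1 hC
  simp only [Finset.mem_insert, Finset.mem_singleton] at hl
  rcases hl with rfl | rfl <;> rfl

theorem isExactCNF (h : IsGraphCNFOf F G) : F.IsExactCNF 2 := by
  intro C hC
  obtain ⟨u, v, huv, rfl⟩ := (h.2 C).1 hC
  refine Finset.card_pair fun he => huv.ne (Subtype.ext ?_)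
  exact congrArg Prod.fst he

theorem vars_eq (h : IsGraphCNFOf F G) : F.vars = V := by
  ext x
  simp only [CNF.vars, clauseVars, Finset.mem_biUnion, Finset.mem_image]
  constructor
  · rintro ⟨C, hC, l, hl, rfl⟩
    obtain ⟨u, v, -, rfl⟩ := (h.2 C).1 hC
    simp only [Finset.mem_insert, Finset.mem_singleton] at hl
    rcases hl with rfl | rfl
    · exact u.2
    · exact v.2
  · intro hx
    obtain ⟨w, hw⟩ := h.1 ⟨x, hx⟩
    exact ⟨_, (h.2 _).2 ⟨_, w, hw, rfl⟩, (x, true), by simp, rfl⟩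

/-- Used to obtain arbitrarily large formulas from arbitrarily large expanders. -/
theorem card_le_size (h : IsGraphCNFOf F G) : V.card ≤ F.size := by
  rw [← h.vars_eq]
  exact Finset.card_biUnion_le.trans (Finset.sum_le_sum fun C _ => Finset.card_image_le)

open Classical in
theorem filter_subset (h : IsGraphCNFOf F G) (v : V) :
    F.clauses.filter (fun C => (v : X) ∈ clauseVars C) ⊆
      (G.neighborFinset v).image fun w : V => {((v : X), true), ((w : X), true)} := by
  intro C hC
  obtain ⟨hC, hv⟩ := Finset.mem_filter.1 hC
  obtain ⟨u, w, huw, rfl⟩ := (h.2 C).1 hC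
  simp only [clauseVars, Finset.mem_image, Finset.mem_insert, Finset.mem_singleton] at hv
  rw [Finset.mem_image]
  obtain ⟨l, rfl | rfl, hl⟩ := hv
  · obtain rfl : u = v := Subtype.ext hl
    exact ⟨w, by simpa using huw, rfl⟩
  · obtain rfl : w = v := Subtype.ext hl
    exact ⟨u, by simpa using huw.symm, Finset.pair_comm _ _⟩

open Classical in
theorem isReadTimes (h : IsGraphCNFOf F G) {d : ℕ} (hd : ∀ v, G.degree v ≤ d) :
    F.IsReadTimes d := by
  intro x
  by_cases hx : x ∈ V
  · refine le_trans ?_ (hd ⟨x, hx⟩)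
    exact (Finset.card_le_card (by convert h.filter_subset ⟨x, hx⟩)).trans Finset.card_image_le
  · rw [Finset.filter_false_of_mem]
    · exact Nat.zero_le d
    · intro C hC hxC
      exact hx (h.vars_eq ▸ Finset.mem_biUnion.2 ⟨C, hC, hxC⟩)

open Classical in
theorem size_le (h : IsGraphCNFOf F G) {d : ℕ} (hd : ∀ v, G.degree v ≤ d) :
    F.size ≤ V.card * d * 2 := by
  have hcl : F.clauses.card ≤ V.card * d := by
    have hsub : F.clauses ⊆ (Finset.univ : Finset V).biUnion fun v =>
        F.clauses.filter fun C => (v : X) ∈ clauseVars C := by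
      intro C hC
      obtain ⟨u, w, -, rfl⟩ := (h.2 C).1 hC
      refine Finset.mem_biUnion.2 ⟨u, Finset.mem_univ _, Finset.mem_filter.2 ⟨hC, ?_⟩⟩
      simp [clauseVars]
    refine (Finset.card_le_card hsub).trans ?_
    rw [← Fintype.card_coe V, ← Finset.card_univ]
    exact Finset.card_biUnion_le_card_mul _ _ _ fun v _ => by convert h.isReadTimes hd v
  rw [CNF.size, Finset.sum_const_nat h.isExactCNF]
  exact Nat.mul_le_mul_right 2 hcl

theorem boolFun_eq_true_iff {F : CNF X} {G : SimpleGraph F.vars} (h : IsGraphCNFOf F G)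
    (β : F.vars → Bool) :
    F.boolFun β = true ↔ ∀ u v, G.Adj u v → β u = true ∨ β v = true := by
  simp only [CNF.boolFun, decide_eq_true_eq]
  constructor
  · intro hs u v huv
    obtain ⟨x, hx⟩ := hs _ ((h.2 _).2 ⟨u, v, huv, rfl⟩)
    simp only [Finset.mem_insert, Finset.mem_singleton, Prod.mk.injEq] at hx
    rcases hx with ⟨h1, h2⟩ | ⟨h1, h2⟩
    · exact .inl (Subtype.ext h1 ▸ h2)
    · exact .inr (Subtype.ext h1 ▸ h2)
  · intro hβ C hC
    obtain ⟨u, v, huv, rfl⟩ := (h.2 C).1 hC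
    rcases hβ u v huv with h1 | h1
    · exact ⟨u, by simp [h1]⟩
    · exact ⟨v, by simp [h1]⟩

/-- The OBDD size of the graph CNF of an expander is exponential in the size of the formula. -/
theorem two_rpow_le_obddSize (h : IsGraphCNFOf F G) {n : ℕ} (hn : 2 ≤ n) {a : ℝ}
    (hG : IsExpander G n 3 a) :
    (2 : ℝ) ^ (a / 396 * (F.size : ℝ)) ≤ (obddSize F.boolFun : ℝ) := by
  classical
  obtain rfl : F.vars = V := h.vars_eq
  -- Nonemptiness matters: `sInf ∅ = 0` in `ℕ`, and only an attained minimum supplies a diagram.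
  obtain ⟨D, hD, hDF, hDs⟩ := Nat.sInf_mem (obddSizes_nonempty F.boolFun)
  obtain ⟨s, hs, hsD⟩ := two_pow_le_size G hG h.boolFun_eq_true_iff hD hDF
  obtain ⟨-, -, ha, -, hcard, hdeg, -⟩ := hG
  have hsize := h.size_le fun v => by convert hdeg v
  rw [Fintype.card_coe] at hcard
  -- The size is at most `6 * n`, and `n ≤ 3 * ⌊n/2⌋` for `n ≥ 2`, with equality at `n = 3`. Then
  -- `396 = 18 * 22`.
  have hsize' : (F.size : ℝ) ≤ 18 * (n / 2 : ℕ) := by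
    exact_mod_cast (by omega : F.size ≤ 18 * (n / 2))
  have hexp : a / 396 * (F.size : ℝ) ≤ (s : ℝ) := by nlinarith
  calc (2 : ℝ) ^ (a / 396 * (F.size : ℝ)) ≤ (2 : ℝ) ^ (s : ℝ) :=
        Real.rpow_le_rpow_of_exponent_le one_le_two hexp
    _ = ((2 ^ s : ℕ) : ℝ) := by rw [Real.rpow_natCast]; push_cast; rfl
    _ ≤ (obddSize F.boolFun : ℝ) := by
        rw [obddSize, ← hDs]
        exact_mod_cast hsD

end IsGraphCNFOf

end OBDDLower

theorem mainTheorem1 :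
    ∃ (𝓕 : Set (OBDDLower.CNF ℕ)) (a c : ℝ), 0 < c ∧
      -- the class contains arbitrarily large formulas
      (∀ N : ℕ, ∃ F ∈ 𝓕, N ≤ F.size) ∧
      ∀ F ∈ 𝓕,
        F.IsReadTimes 3 ∧ F.IsMonotone ∧ F.IsExactCNF 2 ∧
        (∃ (n : ℕ) (V : Finset ℕ) (G : SimpleGraph V),
          OBDDLower.IsExpander G n 3 a ∧ OBDDLower.IsGraphCNFOf F G) ∧
        (2 : ℝ) ^ (c * (F.size : ℝ)) ≤ (OBDDLower.obddSize F.boolFun : ℝ) := by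
  -- Requiring `2 ≤ n` loses nothing, as a one-vertex graph has an isolated vertex.
  refine ⟨{F | ∃ (n : ℕ) (V : Finset ℕ) (G : SimpleGraph V), 2 ≤ n ∧
    OBDDLower.IsExpander G n 3 (1 / 600) ∧ OBDDLower.IsGraphCNFOf F G}, 1 / 600, 1 / 600 / 396,
    by norm_num, fun N => ?_, ?_⟩
  · obtain ⟨n, V, G, hN, hn, hG⟩ := OBDDLower.exists_large_expander N
    have hF := OBDDLower.isGraphCNFOf_graphCNF (hG.exists_adj hn)
    refine ⟨_, ⟨n, V, G, hn, hG, hF⟩, hN.trans (le_of_eq_of_le ?_ hF.card_le_size)⟩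
    obtain ⟨-, -, -, -, hcard, -⟩ := hG
    rw [← hcard, Fintype.card_coe]
  · rintro F ⟨n, V, G, hn, hG, hF⟩
    refine ⟨hF.isReadTimes fun v => ?_, hF.isMonotone, hF.isExactCNF, ⟨n, V, G, hG, hF⟩,
      hF.two_rpow_le_obddSize hn hG⟩
    obtain ⟨-, -, -, -, -, hdeg, -⟩ := hG
    convert hdeg v
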